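/- Let $M$ be a matroid on the ground set $[n]=\{1,\dots,n\}$ of rank $r\ge 2$ (loops and parallel elements are allowed), with set of independent sets $\mathcal I(M)$. Define $$P_M=\sum_{I\in\mathcal I(M)}\Big(\prod_{i\in I}x_i\Big)x_0^{\,n-|I|},\qquad \overline P_M=\Big(\frac{\partial}{\partial x_0}\Big)^{n-r}P_M\ \in\ \mathbb R[x_0,x_1,\dots,x_n].$$ For a homogeneous polynomial $f\in\mathbb R[x_0,\dots,x_n]$ of degree $d$, let $S=\mathbb R[\partial_0,\dots,\partial_n]$ act on $\mathbb R[x_0,\dots,x_n]$ by $\partial_i=\partial/\partial x_i$, let $\mathrm{Ann}_S(f)=\{D\in S: Df=0\}$, and let $R_f=S/\mathrm{Ann}_S(f)$, graded by $R_f^k$, the image of the forms of degree $k$; let $[-]:R_f^d\to\mathbb R$ be $[D]=Df$. For a linear form $\ell\in S$ and an integer $0\le k\le d/2$, say that $f$ has $\mathrm{HRR}_k$ with respect to $\ell$ if 1. ($\mathrm{SLP}_k$) multiplication by $\ell^{d-2k}$ is an isomorphism $R_f^k\to R_f^{d-k}$, and 2. the bilinear form $Q_\ell^k(\xi_1,\xi_2)=(-1)^k[\xi_1\,\ell^{d-2k}\,\xi_2]$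 on $R_f^k$ is positive definite on the kernel of multiplication by $\ell^{d+1-2k}:R_f^k\to R_f^{d-k+1}$. **Theorem 4.1.** For every $\boldsymbol a=(a_1,\dots,a_n)\in\mathbb R^n_{>0}$, the polynomial $\overline P_M$ has $\mathrm{HRR}_1$ with respect to $\ell_{\boldsymbol a}=a_1\partial_1+\cdots+a_n\partial_n$ (there is no $\partial_0$ term). -/

import Mathlib

namespace HodgeRiemann

noncomputable section

open MvPolynomial

/-! ### Polynomials in the partial derivatives acting on polynomials -/

section Action

variable {σ : Type*}

theorem pderiv_comm (i j : σ) (f : MvPolynomial σ ℝ) :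
    pderiv i (pderiv j f) = pderiv j (pderiv i f) := by
  classical
  have h : ⁅(pderiv i : Derivation ℝ (MvPolynomial σ ℝ) (MvPolynomial σ ℝ)), (pderiv j : Derivation ℝ (MvPolynomial σ ℝ) (MvPolynomial σ ℝ))⁆ = 0 := by
    apply MvPolynomial.derivation_ext
    intro k
    rw [Derivation.commutator_apply, pderiv_X, pderiv_X]
    simp only [Pi.single_apply]
    split_ifs <;> simp
  have h2 := congrArg (fun D : Derivation ℝ (MvPolynomial σ ℝ) (MvPolynomial σ ℝ) => D f) h
  simpa [Derivation.commutator_apply, sub_eq_zero] using h2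

/-- The partial derivative `∂ᵢ` as an `ℝ`-linear endomorphism of the polynomial ring. -/
def pderivEnd (i : σ) : Module.End ℝ (MvPolynomial σ ℝ) :=
  (pderiv i : Derivation ℝ (MvPolynomial σ ℝ) (MvPolynomial σ ℝ)).toLinearMap

theorem pderivEnd_mul_comm (a b : Module.End ℝ (MvPolynomial σ ℝ))
    (ha : a ∈ Set.range (pderivEnd (σ := σ))) (hb : b ∈ Set.range (pderivEnd (σ := σ))) :
    a * b = b * a := by
  obtain ⟨i, rfl⟩ := ha
  obtain ⟨j, rfl⟩ := hb
  exact LinearMap.ext fun f => pderiv_comm i j f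

open scoped IsMulCommutative in
/-- The action of `S = ℝ[∂ᵢ : i ∈ σ]` on `ℝ[xᵢ : i ∈ σ]` by constant coefficient differential
operators: the `ℝ`-algebra homomorphism that sends the variable `∂ᵢ` of `S`
(written `X i`) to the partial derivative with respect to `xᵢ`. -/
def diffOp : MvPolynomial σ ℝ →ₐ[ℝ] Module.End ℝ (MvPolynomial σ ℝ) :=
  haveI : IsMulCommutative (Algebra.adjoin ℝ (Set.range (pderivEnd (σ := σ)))) :=
    Algebra.isMulCommutative_adjoin ℝ (fun a ha b hb => pderivEnd_mul_comm a b ha hb)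
  (Algebra.adjoin ℝ (Set.range (pderivEnd (σ := σ)))).val.comp
    (MvPolynomial.aeval fun i =>
      (⟨pderivEnd i, Algebra.subset_adjoin (Set.mem_range_self i)⟩ :
        Algebra.adjoin ℝ (Set.range (pderivEnd (σ := σ)))))

@[simp] theorem diffOp_X (i : σ) (f : MvPolynomial σ ℝ) : diffOp (X i) f = pderiv i f := by
  simp [diffOp, pderivEnd]

/-! ### The algebra `R_f = S / Ann_S(f)` and its graded pieces -/

/-- `Ann_S(f) = {D ∈ S | D f = 0}`. -/
def annIdeal (f : MvPolynomial σ ℝ) : Ideal (MvPolynomial σ ℝ) where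
  carrier := {D | diffOp D f = 0}
  add_mem' {D E} hD hE := by
    simp only [Set.mem_ofPred_eq] at hD hE ⊢
    rw [map_add, LinearMap.add_apply, hD, hE, add_zero]
  zero_mem' := by simp
  smul_mem' D E hE := by
    simp only [Set.mem_ofPred_eq] at hE ⊢
    rw [smul_eq_mul, map_mul, Module.End.mul_apply, hE, map_zero]

theorem mem_annIdeal {f D : MvPolynomial σ ℝ} : D ∈ annIdeal f ↔ diffOp D f = 0 := Iff.rfl

/-- The `ℝ`-algebra `R_f = S / Ann_S(f)`. -/
abbrev GorensteinAlg (f : MvPolynomial σ ℝ) : Type _ := MvPolynomial σ ℝ ⧸ annIdeal f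

/-- The class in `R_f` of an element of `S`. -/
abbrev toR (f : MvPolynomial σ ℝ) : MvPolynomial σ ℝ →ₐ[ℝ] GorensteinAlg f :=
  Ideal.Quotient.mkₐ ℝ (annIdeal f)

/-- The graded piece `R_f^k`: the image in `R_f` of the forms of degree `k` of `S`. -/
def gradedPiece (f : MvPolynomial σ ℝ) (k : ℕ) : Submodule ℝ (GorensteinAlg f) :=
  (homogeneousSubmodule σ ℝ k).map (toR f).toLinearMap

/-- The linear functional on `R_f` sending the class of `D` to the constant term of `D f`.
For `f` homogeneous of degree `d` and `D` of degree `d` the polynomial `D f` is a constant, so on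
`R_f^d` this is the isomorphism `[D] = D f` onto `ℝ`. -/
def degMap (f : MvPolynomial σ ℝ) : GorensteinAlg f →ₗ[ℝ] ℝ :=
  (((annIdeal f).restrictScalars ℝ).liftQ
    ((MvPolynomial.lcoeff ℝ (0 : σ →₀ ℕ)) ∘ₗ (LinearMap.applyₗ f) ∘ₗ (diffOp (σ := σ)).toLinearMap)
    (fun D hD => by
      have h : diffOp D f = 0 := hD
      simp [h])) ∘ₗ
  (Submodule.Quotient.restrictScalarsEquiv ℝ (annIdeal f)).symm.toLinearMap

@[simp] theorem degMap_toR (f D : MvPolynomial σ ℝ) :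
    degMap f (toR f D) = coeff 0 (diffOp D f) := rfl

/-! ### The strong Lefschetz property and the Hodge-Riemann relation -/

/-- `f` has the strong Lefschetz property at degree `k` with respect to `ℓ`: `f` is homogeneous
of some degree `d = deg f` with `k ≤ d / 2`, `ℓ` is a linear form of `S`, and multiplication by
`ℓ ^ (d - 2k)` is an isomorphism from `R_f^k` to `R_f^{d-k}`. -/
def HasSLP (f : MvPolynomial σ ℝ) (k : ℕ) (ℓ : MvPolynomial σ ℝ) : Prop :=
  f.IsHomogeneous f.totalDegree ∧ 2 * k ≤ f.totalDegree ∧ ℓ.IsHomogeneous 1 ∧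
    Set.BijOn (fun ξ : GorensteinAlg f => toR f ℓ ^ (f.totalDegree - 2 * k) * ξ)
      (gradedPiece f k) (gradedPiece f (f.totalDegree - k))

/-- The Hodge-Riemann form `Q(ξ₁, ξ₂) = (-1)^k [ξ₁ ℓ^(d-2k) ξ₂]`, `d = deg f`, to be used
for `ξ₁, ξ₂` in `R_f^k`. -/
def hrForm (f : MvPolynomial σ ℝ) (k : ℕ) (ℓ : MvPolynomial σ ℝ) (ξ₁ ξ₂ : GorensteinAlg f) : ℝ :=
  (-1) ^ k * degMap f (ξ₁ * toR f ℓ ^ (f.totalDegree - 2 * k) * ξ₂)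

/-- `f` satisfies the Hodge-Riemann relation at degree `k` with respect to `ℓ`: it has the strong
Lefschetz property at degree `k`, and the Hodge-Riemann form is positive definite on the kernel
of the multiplication by `ℓ ^ (d + 1 - 2k)` on `R_f^k`, where `d = deg f`. -/
def HasHRR (f : MvPolynomial σ ℝ) (k : ℕ) (ℓ : MvPolynomial σ ℝ) : Prop :=
  HasSLP f k ℓ ∧
    ∀ ξ ∈ gradedPiece f k, toR f ℓ ^ (f.totalDegree + 1 - 2 * k) * ξ = 0 → ξ ≠ 0 →
      0 < hrForm f k ℓ ξ ξ

end Action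

/-! ### Independent set generating polynomials

The variables `x₀, x₁, …, xₙ` are indexed by `Fin (n + 1)`; the element `i : Fin n` of the ground
set corresponds to the variable with index `i.succ`. -/

open Classical in
/-- `P_M = ∑_{I independent} x₀^(n - |I|) ∏_{i ∈ I} xᵢ`. -/
def indepPoly {n : ℕ} (M : Matroid (Fin n)) : MvPolynomial (Fin (n + 1)) ℝ :=
  ∑ I ∈ Finset.univ.filter (fun I : Finset (Fin n) => M.Indep (I : Set (Fin n))),
    (∏ i ∈ I, X i.succ) * X 0 ^ (n - I.card)

/-- The reduced independent set generating polynomial `(∂/∂x₀)^(n - r) P_M`, `r` the rank. -/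
def reducedIndepPoly {n : ℕ} (M : Matroid (Fin n)) : MvPolynomial (Fin (n + 1)) ℝ :=
  (fun p => pderiv 0 p)^[n - M.eRank.toNat] (indepPoly M)

/-- The linear form `ℓ_a = a₁∂₁ + ⋯ + aₙ∂ₙ` of `ℝ[∂₀, ∂₁, …, ∂ₙ]` (there is no `∂₀` term). -/
def linForm {n : ℕ} (a : Fin n → ℝ) : MvPolynomial (Fin (n + 1)) ℝ :=
  ∑ i : Fin n, C (a i) * X i.succ

end

end HodgeRiemann

/-!
Let `f` be the reduced independent set polynomial, of degree `r`. The proof works with the Hodge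
index inequality for the forms `(v, w) ↦ ∂_v ∂_w ∂_a ^ (r - 2) f` and with the injectivity of
`ℓ_a ^ (r - 2)` on `R_f^1`. Both properties together give the Hodge-Riemann relation
(`StrictHodgeIndexAt.hasHRR_one`): surjectivity onto `R_f^{r-1}` follows by Gorenstein duality, and
a primitive class on which the form vanishes lies in the radical of the form.

All partial derivatives of a reduced independent set polynomial are zero or polynomials of the same
kind: `∂ᵢ` contracts the non-loop `i`, and `∂₀` truncates the matroid. So both properties can be
passed from the partial derivatives to the polynomial.

For `a` with all coordinates positive, including `a₀`, the Hodge index inequality is obtained by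
trickle-down (`HodgeIndexAt.of_pderiv`): the inequalities of the derivatives say that the random
walk operator `P` of the Hessian of `∂_a ^ (r - 2) f` satisfies `P ≤ P ^ 2`. Hence its eigenvalues
are nonpositive or `1`, and the eigenvalue `1` is simple because `∂₀ ∂ᵢ ∂_a ^ (r - 2) f > 0` for each
non-loop `i`. In degree two the inequality is the Cauchy-Schwarz inequality for the weights of the
parallel classes, of which there are at most as many as elements. The case `a₀ = 0` is a limit.

Injectivity is proved for `a₀ ≥ 0` (`diffOp_pderiv_eq_zero_of_strictHodgeIndexAt`): if
`∂_v ∂_a ^ (r - 2) f = 0`, then `v` is primitive for every `∂ᵢ f`, and the nonpositive numbers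
`aᵢ ∂_v ^ 2 ∂_a ^ (r - 3) ∂ᵢ f` add up to zero, so each is zero and `∂_v ∂ᵢ f = 0` whenever `aᵢ > 0`.
As `a₀` may be zero this leaves a multiple of `x₀ ^ (r - 1)` in `∂_v f`. Its coefficient vanishes by
a comparison of the weights of the flats of rank one and two with that of the whole matroid
(`mul_add_sum_nonloops_eq_zero`).
-/

namespace HodgeRiemann

open MvPolynomial
open scoped Matroid

/-! ### Symmetric forms with one positive direction -/

/-- Reversed Cauchy-Schwarz inequality: a form which is nonpositive on some hyperplane `ker l` has
at most one positive direction. -/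
theorem mul_apply_self_le_sq {V : Type*} [AddCommGroup V] [Module ℝ V]
    (B : LinearMap.BilinForm ℝ V) (hB : ∀ v w, B v w = B w v) (l : V →ₗ[ℝ] ℝ)
    (hl : ∀ w, l w = 0 → B w w ≤ 0) {a : V} (ha : 0 < B a a) (v : V) :
    B v v * B a a ≤ B v a ^ 2 := by
  have hla : l a ≠ 0 := fun h => absurd (hl a h) (not_le.2 ha)
  -- the combination of `v` and `a` lying in `ker l`
  have h1 := hl (l a • v - l v • a) (by simp [mul_comm])
  have h2 : B (l a • v - l v • a) (l a • v - l v • a)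
      = l a ^ 2 * B v v - 2 * (l a * l v) * B v a + l v ^ 2 * B a a := by
    simp only [map_sub, map_smul, LinearMap.sub_apply, LinearMap.smul_apply, smul_eq_mul, hB a v]
    ring
  rw [h2] at h1
  have h3 : 0 < l a ^ 2 := by positivity
  refine le_of_mul_le_mul_left ?_ h3
  nlinarith [sq_nonneg (l v * B a a - l a * B v a), mul_le_mul_of_nonneg_right h1 ha.le]

/-- A null vector orthogonal to a positive vector `a` of a form with one positive direction lies in
the radical. -/
theorem apply_eq_zero_of_apply_self_eq_zero {V : Type*} [AddCommGroup V] [Module ℝ V]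
    (B : LinearMap.BilinForm ℝ V) (hB : ∀ v w, B v w = B w v) {a : V} (ha : 0 < B a a)
    (hH : ∀ v, B v v * B a a ≤ B v a ^ 2) {v : V} (hva : B v a = 0) (hvv : B v v = 0) (w : V) :
    B v w = 0 := by
  by_contra hne
  -- the inequality for `w + t • v` is affine in `t`, so it fails for a suitable `t`
  have h := hH (w + ((B w a ^ 2 - B w w * B a a + 1) / (2 * B v w * B a a)) • v)
  simp only [map_add, map_smul, LinearMap.add_apply, LinearMap.smul_apply, smul_eq_mul, hB w v,
    hva, hvv] at h
  have h2 : (B w a ^ 2 - B w w * B a a + 1) / (2 * B v w * B a a) * B v w * B a a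
      = (B w a ^ 2 - B w w * B a a + 1) / 2 := by
    field_simp
  nlinarith

open Matrix in
/-- Spectral form of the trickle-down principle. Let `W` be the weight matrix of a graph in which
`o` is a neighbour of every vertex of nonzero weight. The hypothesis `hW` says that the random walk
operator `P` of `W` satisfies `P ≤ P ^ 2`, so its positive eigenvalues are at least `1`, hence equal
to `1`, and by connectedness only the constants are fixed by `P`. Therefore `P` is negative
semidefinite on the orthogonal complement of the constants. Vertices of weight zero are covered by
`x / 0 = 0`. -/
theorem dotProduct_mulVec_nonpos_of_le_sum_sq_div {ι : Type*} [Fintype ι] [DecidableEq ι]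
    (W : Matrix ι ι ℝ) (hsymm : ∀ i j, W i j = W j i) (h0 : ∀ i j, 0 ≤ W i j) (o : ι)
    (ho : ∀ i, W o i = 0 → ∑ j, W i j = 0)
    (hW : ∀ y, y ⬝ᵥ W *ᵥ y ≤ ∑ i, (W *ᵥ y) i ^ 2 / ∑ j, W i j)
    {y : ι → ℝ} (hy : ∑ i, (∑ j, W i j) * y i = 0) : y ⬝ᵥ W *ᵥ y ≤ 0 := by
  set w : ι → ℝ := fun i => ∑ j, W i j with hw
  have hw0 : ∀ i, 0 ≤ w i := fun i => Finset.sum_nonneg fun j _ => h0 i j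
  have hWz : ∀ i j, w i = 0 → W i j = 0 := fun i j h =>
    (Finset.sum_eq_zero_iff_of_nonneg fun j _ => h0 i j).1 h j (Finset.mem_univ j)
  set s : ι → ℝ := fun i => √(w i) with hs
  have hss : ∀ i, s i * s i = w i := fun i => Real.mul_self_sqrt (hw0 i)
  have hsz : ∀ i, s i = 0 → w i = 0 := fun i h => by rw [← hss, h, zero_mul]
  -- the symmetric normalisation of `W`; rows and columns with `w i = 0` vanish
  let B : Matrix ι ι ℝ := Matrix.of fun i j => W i j / (s i * s j)
  have hBv : ∀ z i, (B *ᵥ z) i = (W *ᵥ fun j => z j / s j) i / s i := by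
    intro z i
    simp only [Matrix.mulVec, dotProduct, B, Matrix.of_apply, Finset.sum_div]
    exact Finset.sum_congr rfl fun j _ => by ring
  have hBq : ∀ z, z ⬝ᵥ B *ᵥ z = (fun j => z j / s j) ⬝ᵥ W *ᵥ fun j => z j / s j := by
    intro z
    simp only [dotProduct, hBv]
    exact Finset.sum_congr rfl fun j _ => by ring
  have hBsq : ∀ z, z ⬝ᵥ B *ᵥ z ≤ ∑ i, (B *ᵥ z) i ^ 2 := by
    intro z
    rw [hBq]
    refine (hW _).trans (le_of_eq (Finset.sum_congr rfl fun i _ => ?_))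
    rw [hBv, div_pow, sq (s i), hss]
  have hBH : B.IsHermitian := by
    ext i j
    simp [B, hsymm i j, mul_comm]
  -- an eigenvector with positive eigenvalue is proportional to `s`
  have heig : ∀ (e : ι → ℝ) (c : ℝ), 0 < c → B *ᵥ e = c • e → ∃ t, ∀ i, e i = t * s i := by
    intro e c hc he
    set u : ι → ℝ := fun j => e j / s j with hu
    have hE0 : 0 ≤ ∑ i, e i ^ 2 := Finset.sum_nonneg fun i _ => sq_nonneg _
    have h1 : e ⬝ᵥ B *ᵥ e = c * ∑ i, e i ^ 2 := by
      rw [he]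
      simp only [dotProduct, Pi.smul_apply, smul_eq_mul, Finset.mul_sum]
      exact Finset.sum_congr rfl fun i _ => by ring
    -- `c ≤ c ^ 2` gives `1 ≤ c`, and then the Dirichlet form of `u` is nonpositive
    have h2 : c * ∑ i, e i ^ 2 ≤ c ^ 2 * ∑ i, e i ^ 2 := by
      rw [← h1]
      refine (hBsq e).trans (le_of_eq ?_)
      rw [he, Finset.mul_sum]
      exact Finset.sum_congr rfl fun i _ => by simp only [Pi.smul_apply, smul_eq_mul]; ring
    have h3 : ∑ i, e i ^ 2 ≤ c * ∑ i, e i ^ 2 := by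
      refine le_of_mul_le_mul_left ?_ hc
      linarith
    have h4 : ∑ i, ∑ j, W i j * (u i - u j) ^ 2
        = 2 * ∑ i, w i * u i ^ 2 - 2 * (u ⬝ᵥ W *ᵥ u) := by
      have e1 : ∑ i, ∑ j, W i j * u i ^ 2 = ∑ i, w i * u i ^ 2 := by
        simp only [hw, Finset.sum_mul]
      have e2 : ∑ i, ∑ j, W i j * u j ^ 2 = ∑ i, w i * u i ^ 2 := by
        rw [Finset.sum_comm, ← e1]
        exact Finset.sum_congr rfl fun i _ => Finset.sum_congr rfl fun j _ => by rw [hsymm]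
      have e3 : u ⬝ᵥ W *ᵥ u = ∑ i, ∑ j, W i j * (u i * u j) := by
        simp only [dotProduct, Matrix.mulVec, Finset.mul_sum]
        exact Finset.sum_congr rfl fun i _ => Finset.sum_congr rfl fun j _ => by ring
      rw [two_mul, e3]
      nth_rewrite 1 [← e1]
      rw [← e2, Finset.mul_sum, ← Finset.sum_add_distrib, ← Finset.sum_sub_distrib]
      refine Finset.sum_congr rfl fun i _ => ?_
      rw [Finset.mul_sum, ← Finset.sum_add_distrib, ← Finset.sum_sub_distrib]
      exact Finset.sum_congr rfl fun j _ => by ring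
    have h5 : ∑ i, w i * u i ^ 2 ≤ ∑ i, e i ^ 2 := by
      refine Finset.sum_le_sum fun i _ => ?_
      by_cases h : s i = 0
      · rw [hsz i h, zero_mul]; positivity
      · rw [← hss, hu]
        exact le_of_eq (by field_simp)
    have h6 : ∑ i, ∑ j, W i j * (u i - u j) ^ 2 ≤ 0 := by
      rw [h4, hu, ← hBq, h1]
      linarith
    have h7 : ∀ j, W o j * (u o - u j) ^ 2 = 0 := by
      have hnn : ∀ i j, 0 ≤ W i j * (u i - u j) ^ 2 := fun i j =>
        mul_nonneg (h0 i j) (sq_nonneg _)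
      have h8 := (Finset.sum_eq_zero_iff_of_nonneg fun i _ =>
        Finset.sum_nonneg fun j _ => hnn i j).1
        (le_antisymm h6 (Finset.sum_nonneg fun i _ => Finset.sum_nonneg fun j _ => hnn i j))
        o (Finset.mem_univ o)
      exact fun j => (Finset.sum_eq_zero_iff_of_nonneg fun j _ => hnn o j).1 h8 j
        (Finset.mem_univ j)
    refine ⟨u o, fun j => ?_⟩
    by_cases hj : w j = 0
    · have hsj : s j = 0 := by simp [hs, hj]
      have h9 := congrFun he j
      rw [hBv, hsj, div_zero, Pi.smul_apply, smul_eq_mul] at h9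
      rw [hsj, mul_zero]
      exact (mul_eq_zero.1 h9.symm).resolve_left hc.ne'
    · have hsj : s j ≠ 0 := fun h => hj (hsz j h)
      have h9 : u o = u j := by
        have := (mul_eq_zero.1 (h7 j)).resolve_left fun h => hj (ho j h)
        nlinarith [sub_eq_zero.1 (pow_eq_zero_iff two_ne_zero |>.1 this)]
      rw [h9, hu]
      field_simp
  set z : ι → ℝ := fun i => s i * y i with hz
  have hyz : y ⬝ᵥ W *ᵥ y = z ⬝ᵥ B *ᵥ z := by
    rw [hBq]
    simp only [dotProduct, Matrix.mulVec, hz, Finset.mul_sum]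
    refine Finset.sum_congr rfl fun i _ => Finset.sum_congr rfl fun j _ => ?_
    by_cases hi : s i = 0
    · rw [hWz i j (hsz i hi)]; ring
    by_cases hj : s j = 0
    · rw [hsymm, hWz j i (hsz j hj)]; ring
    · field_simp
  have hspec : z ⬝ᵥ B *ᵥ z
      = ∑ k, hBH.eigenvalues k * (⇑(hBH.eigenvectorBasis k) ⬝ᵥ z) ^ 2 := by
    have h1 := hBH.eigenvectorBasis.sum_inner_mul_inner
      (WithLp.toLp 2 z) (WithLp.toLp 2 (B *ᵥ z))
    simp only [EuclideanSpace.inner_eq_star_dotProduct, star_trivial] at h1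
    rw [dotProduct_comm, ← h1]
    refine Finset.sum_congr rfl fun k _ => ?_
    have h2 : (B *ᵥ z) ⬝ᵥ ⇑(hBH.eigenvectorBasis k)
        = hBH.eigenvalues k * (⇑(hBH.eigenvectorBasis k) ⬝ᵥ z) := by
      have hBT : Bᵀ = B := by
        have := hBH.eq
        rwa [conjTranspose_eq_transpose_of_trivial] at this
      rw [dotProduct_comm, dotProduct_mulVec, ← mulVec_transpose, hBT,
        hBH.mulVec_eigenvectorBasis, smul_dotProduct, smul_eq_mul]
    rw [h2]
    ring
  rw [hyz, hspec]
  refine Finset.sum_nonpos fun k _ => ?_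
  rcases le_or_gt (hBH.eigenvalues k) 0 with hk | hk
  · exact mul_nonpos_of_nonpos_of_nonneg hk (sq_nonneg _)
  · obtain ⟨t, ht⟩ := heig _ _ hk (hBH.mulVec_eigenvectorBasis k)
    have h0 : ⇑(hBH.eigenvectorBasis k) ⬝ᵥ z = 0 := by
      have : ⇑(hBH.eigenvectorBasis k) ⬝ᵥ z = t * ∑ i, w i * y i := by
        simp only [dotProduct, hz, Finset.mul_sum, ← hss]
        exact Finset.sum_congr rfl fun i _ => by rw [ht]; ring
      rw [this, hy, mul_zero]
    rw [h0]
    simp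

/-! ### The degree pairing between operators and polynomials -/

section Pairing

variable {σ : Type*}

/-- The pairing `D ↦ (D f)(0)` of `S` with a fixed polynomial `f`. On operators of degree `deg f`
it is the functional `[D] = D f`. -/
noncomputable def pairing (f : MvPolynomial σ ℝ) : MvPolynomial σ ℝ →ₗ[ℝ] ℝ :=
  MvPolynomial.lcoeff ℝ (0 : σ →₀ ℕ) ∘ₗ LinearMap.applyₗ f ∘ₗ (diffOp (σ := σ)).toLinearMap

theorem pairing_apply (f D : MvPolynomial σ ℝ) : pairing f D = coeff 0 (diffOp D f) := rfl

theorem diffOp_mul_apply (D E f : MvPolynomial σ ℝ) :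
    diffOp (D * E) f = diffOp D (diffOp E f) := by
  rw [map_mul, Module.End.mul_apply]

theorem pairing_mul (f D E : MvPolynomial σ ℝ) :
    pairing f (D * E) = pairing (diffOp D f) E := by
  rw [pairing_apply, mul_comm, diffOp_mul_apply, pairing_apply]

theorem pairing_X_mul (f D : MvPolynomial σ ℝ) (i : σ) :
    pairing f (X i * D) = pairing (pderiv i f) D := by
  rw [pairing_mul, diffOp_X]

theorem pairing_zero_left (D : MvPolynomial σ ℝ) : pairing (0 : MvPolynomial σ ℝ) D = 0 := by
  simp [pairing_apply]

theorem diffOp_pderiv (D f : MvPolynomial σ ℝ) (i : σ) :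
    diffOp D (pderiv i f) = pderiv i (diffOp D f) := by
  rw [← diffOp_X, ← diffOp_X, ← diffOp_mul_apply, mul_comm, diffOp_mul_apply]

theorem isHomogeneous_diffOp_monomial (m : σ →₀ ℕ) :
    ∀ {n : ℕ} {f : MvPolynomial σ ℝ}, f.IsHomogeneous n →
      (diffOp (monomial m 1) f).IsHomogeneous (n - m.degree) := by
  induction m using Finsupp.induction_linear with
  | zero => intro n f hf; simpa using hf
  | add m₁ m₂ h₁ h₂ =>
    intro n f hf
    have h : (monomial (m₁ + m₂) (1 : ℝ)) = monomial m₁ 1 * monomial m₂ 1 := by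
      rw [monomial_mul, one_mul]
    rw [h, diffOp_mul_apply, map_add, add_comm, ← Nat.sub_sub]
    exact h₁ (h₂ hf)
  | single i k =>
    have h : (monomial (Finsupp.single i k) (1 : ℝ)) = X i ^ k := by
      rw [X_pow_eq_monomial]
    rw [h, Finsupp.degree_single]
    induction k with
    | zero => intro n f hf; simpa using hf
    | succ k ih =>
      intro n f hf
      rw [pow_succ, diffOp_mul_apply, diffOp_X, add_comm, ← Nat.sub_sub]
      exact ih (by rw [X_pow_eq_monomial]) hf.pderiv

theorem isHomogeneous_diffOp {D f : MvPolynomial σ ℝ} {k n : ℕ} (hD : D.IsHomogeneous k)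
    (hf : f.IsHomogeneous n) : (diffOp D f).IsHomogeneous (n - k) := by
  rw [← support_sum_monomial_coeff D, map_sum, LinearMap.sum_apply]
  refine IsHomogeneous.sum _ _ _ fun m hm => ?_
  have h : monomial m (coeff m D) = coeff m D • monomial m 1 := by
    rw [smul_monomial, smul_eq_mul, mul_one]
  rw [h, map_smul, LinearMap.smul_apply, smul_eq_C_mul]
  have hk : m.degree = k := by
    by_contra hne
    exact (mem_support_iff.1 hm) (hD.coeff_eq_zero hne)
  exact hk ▸ (isHomogeneous_diffOp_monomial m hf).C_mul _

theorem eq_C_coeff_zero_of_isHomogeneous_zero {g : MvPolynomial σ ℝ} (hg : g.IsHomogeneous 0) :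
    g = C (coeff 0 g) :=
  totalDegree_eq_zero_iff_eq_C.1 ((totalDegree_zero_iff_isHomogeneous _).2 hg)

theorem continuous_pairing_mul_pow (f A B : MvPolynomial σ ℝ) (d : ℕ) :
    ∀ D, Continuous fun t : ℝ => pairing f (D * (A + t • B) ^ d) := by
  induction d with
  | zero => intro D; simpa using continuous_const
  | succ d ih =>
    intro D
    have h : (fun t : ℝ => pairing f (D * (A + t • B) ^ (d + 1)))
        = fun t => pairing f (D * A * (A + t • B) ^ d)
          + t * pairing f (D * B * (A + t • B) ^ d) := by
      funext t
      rw [← smul_eq_mul (a := t), ← map_smul, ← map_add]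
      congr 1
      simp only [smul_eq_C_mul]
      ring
    rw [h]
    exact (ih _).add (continuous_id.mul (ih _))

variable [Fintype σ]

theorem eq_zero_of_forall_pderiv_eq_zero {g : MvPolynomial σ ℝ} {k : ℕ}
    (hg : g.IsHomogeneous (k + 1)) (h : ∀ i, pderiv i g = 0) : g = 0 := by
  have h1 := hg.sum_X_mul_pderiv
  simp only [h, mul_zero, Finset.sum_const_zero] at h1
  exact (smul_eq_zero.1 h1.symm).resolve_left (Nat.succ_ne_zero k)

/-- Gorenstein duality: an operator of degree `deg f - 1` that pairs to zero with all linear forms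
annihilates `f`. -/
theorem diffOp_eq_zero_of_forall_pairing_X_mul {f D : MvPolynomial σ ℝ} {k : ℕ}
    (hf : f.IsHomogeneous (k + 1)) (hD : D.IsHomogeneous k)
    (h : ∀ i, pairing f (X i * D) = 0) : diffOp D f = 0 := by
  have hg : (diffOp D f).IsHomogeneous (0 + 1) := by
    have := isHomogeneous_diffOp hD hf
    rwa [Nat.add_sub_cancel_left, ← zero_add 1] at this
  refine eq_zero_of_forall_pderiv_eq_zero hg fun i => ?_
  rw [eq_C_coeff_zero_of_isHomogeneous_zero (hg.pderiv (i := i)), ← diffOp_X, ← diffOp_mul_apply,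
    ← pairing_apply, h, C_0]

/-- The linear form `∑ vᵢ ∂ᵢ` of `S` with coefficient vector `v`. -/
noncomputable def linearForm : (σ → ℝ) →ₗ[ℝ] MvPolynomial σ ℝ :=
  Fintype.linearCombination ℝ (X : σ → MvPolynomial σ ℝ)

theorem linearForm_apply (v : σ → ℝ) : linearForm v = ∑ i, v i • (X i : MvPolynomial σ ℝ) :=
  Fintype.linearCombination_apply ℝ _ v

theorem linearForm_single [DecidableEq σ] (i : σ) :
    linearForm (Pi.single i (1 : ℝ)) = (X i : MvPolynomial σ ℝ) := by
  rw [linearForm, Fintype.linearCombination_apply_single, one_smul]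

theorem isHomogeneous_linearForm (v : σ → ℝ) : (linearForm v).IsHomogeneous 1 := by
  rw [linearForm_apply]
  refine IsHomogeneous.sum _ _ _ fun i _ => ?_
  rw [smul_eq_C_mul]
  exact (isHomogeneous_X ℝ i).C_mul _

theorem exists_linearForm_eq {p : MvPolynomial σ ℝ} (hp : p.IsHomogeneous 1) :
    ∃ v, linearForm v = p := by
  refine ⟨fun i => coeff 0 (pderiv i p), ?_⟩
  have h := hp.sum_X_mul_pderiv
  rw [one_smul] at h
  rw [linearForm_apply]
  conv_rhs => rw [← h]
  refine Finset.sum_congr rfl fun i _ => ?_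
  conv_rhs => rw [eq_C_coeff_zero_of_isHomogeneous_zero (hp.pderiv (i := i))]
  rw [smul_eq_C_mul, mul_comm]

theorem pairing_linearForm_mul (f D : MvPolynomial σ ℝ) (v : σ → ℝ) :
    pairing f (linearForm v * D) = ∑ i, v i * pairing f (X i * D) := by
  rw [linearForm_apply, Finset.sum_mul, map_sum]
  exact Finset.sum_congr rfl fun i _ => by rw [smul_mul_assoc, map_smul, smul_eq_mul]

/-- The symmetric bilinear form `(v, w) ↦ [∂_v ∂_w D]` attached to `f`. -/
noncomputable def hodgeForm (f D : MvPolynomial σ ℝ) : LinearMap.BilinForm ℝ (σ → ℝ) :=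
  LinearMap.mk₂ ℝ (fun v w => pairing f (linearForm v * (linearForm w * D)))
    (fun v v' w => by rw [map_add, add_mul, map_add])
    (fun c v w => by rw [map_smul, smul_mul_assoc, map_smul])
    (fun v w w' => by rw [map_add, add_mul, mul_add, map_add])
    (fun c v w => by rw [map_smul, smul_mul_assoc, mul_smul_comm, map_smul])

theorem hodgeForm_apply (f D : MvPolynomial σ ℝ) (v w : σ → ℝ) :
    hodgeForm f D v w = pairing f (linearForm v * (linearForm w * D)) := rfl

theorem hodgeForm_comm (f D : MvPolynomial σ ℝ) (v w : σ → ℝ) :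
    hodgeForm f D v w = hodgeForm f D w v := by
  rw [hodgeForm_apply, hodgeForm_apply, mul_left_comm]

/-- `f`, of degree `d + 2`, satisfies the Hodge index inequality at `a`: the form
`[∂_v ∂_w ∂_a ^ d]` is positive at `a` and has no second positive direction. -/
structure HodgeIndexAt (f : MvPolynomial σ ℝ) (d : ℕ) (a : σ → ℝ) : Prop where
  pos : 0 < pairing f (linearForm a ^ (d + 2))
  le_sq : ∀ v, pairing f (linearForm v * (linearForm v * linearForm a ^ d)) *
    pairing f (linearForm a ^ (d + 2)) ≤ pairing f (linearForm v * linearForm a ^ (d + 1)) ^ 2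

/-- The Hodge index inequality together with injectivity of multiplication by `ℓ_a ^ d` on
`R_f^1`. -/
structure StrictHodgeIndexAt (f : MvPolynomial σ ℝ) (d : ℕ) (a : σ → ℝ) : Prop
    extends HodgeIndexAt f d a where
  inj : ∀ v, diffOp (linearForm a ^ d * linearForm v) f = 0 → diffOp (linearForm v) f = 0

theorem hodgeForm_pow_apply_self (f : MvPolynomial σ ℝ) (d : ℕ) (a : σ → ℝ) :
    hodgeForm f (linearForm a ^ d) a a = pairing f (linearForm a ^ (d + 2)) := by
  rw [hodgeForm_apply]; congr 1; ring

theorem hodgeForm_pow_apply (f : MvPolynomial σ ℝ) (d : ℕ) (a v : σ → ℝ) :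
    hodgeForm f (linearForm a ^ d) v a = pairing f (linearForm v * linearForm a ^ (d + 1)) := by
  rw [hodgeForm_apply]; congr 1; ring

/-- It suffices to find one hyperplane on which the form is nonpositive. -/
theorem HodgeIndexAt.of_linearMap {f : MvPolynomial σ ℝ} {d : ℕ} {a : σ → ℝ}
    (pos : 0 < pairing f (linearForm a ^ (d + 2))) (l : (σ → ℝ) →ₗ[ℝ] ℝ)
    (hl : ∀ w, l w = 0 → pairing f (linearForm w * (linearForm w * linearForm a ^ d)) ≤ 0) :
    HodgeIndexAt f d a where
  pos := pos
  le_sq v := by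
    have h := mul_apply_self_le_sq (hodgeForm f (linearForm a ^ d)) (hodgeForm_comm f _) l hl
      (a := a) (by rwa [hodgeForm_pow_apply_self]) v
    rwa [hodgeForm_pow_apply_self, hodgeForm_pow_apply] at h

theorem HodgeIndexAt.nonpos {f : MvPolynomial σ ℝ} {d : ℕ} {a v : σ → ℝ} (h : HodgeIndexAt f d a)
    (hv : pairing f (linearForm v * linearForm a ^ (d + 1)) = 0) :
    pairing f (linearForm v * (linearForm v * linearForm a ^ d)) ≤ 0 := by
  have h1 := h.le_sq v
  rw [hv] at h1
  by_contra h2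
  nlinarith [mul_pos (not_le.1 h2) h.pos]

/-- A primitive class on which the Hodge-Riemann form vanishes is zero. -/
theorem StrictHodgeIndexAt.diffOp_eq_zero {f : MvPolynomial σ ℝ} {d : ℕ} {a v : σ → ℝ}
    (h : StrictHodgeIndexAt f d a) (hf : f.IsHomogeneous (d + 2))
    (hv : pairing f (linearForm v * linearForm a ^ (d + 1)) = 0)
    (hvv : pairing f (linearForm v * (linearForm v * linearForm a ^ d)) = 0) :
    diffOp (linearForm v) f = 0 := by
  classical
  refine h.inj v (diffOp_eq_zero_of_forall_pairing_X_mul hf ?_ fun i => ?_)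
  · simpa using ((isHomogeneous_linearForm a).pow d).mul (isHomogeneous_linearForm v)
  · have h1 := apply_eq_zero_of_apply_self_eq_zero (hodgeForm f (linearForm a ^ d))
      (hodgeForm_comm f _) (a := a) (by rw [hodgeForm_pow_apply_self]; exact h.pos)
      (fun v => by rw [hodgeForm_pow_apply_self, hodgeForm_pow_apply]; exact h.le_sq v)
      (by rw [hodgeForm_pow_apply]; exact hv) hvv (Pi.single i 1)
    rw [hodgeForm_comm, hodgeForm_apply, linearForm_single] at h1
    rw [← h1, mul_comm (linearForm v)]

/-- Local-to-global step for strictness: the Hodge-Riemann forms of the partial derivatives of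
`f` add up to the form of `f`, and they are all semidefinite of the same sign on a class
annihilated by `ℓ_a ^ (d + 1)`. -/
theorem diffOp_pderiv_eq_zero_of_strictHodgeIndexAt {f : MvPolynomial σ ℝ} {d : ℕ}
    {a v : σ → ℝ} (hf : f.IsHomogeneous (d + 3)) (ha : ∀ i, 0 ≤ a i)
    (hs : ∀ i, 0 < a i → pderiv i f = 0 ∨ StrictHodgeIndexAt (pderiv i f) d a)
    (hv : diffOp (linearForm a ^ (d + 1) * linearForm v) f = 0) {i : σ} (hi : 0 < a i) :
    diffOp (linearForm v) (pderiv i f) = 0 := by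
  have hprim : ∀ j, pairing (pderiv j f) (linearForm v * linearForm a ^ (d + 1)) = 0 := by
    intro j
    rw [pairing_apply, mul_comm, diffOp_pderiv, hv, map_zero, coeff_zero]
  have hsum : ∑ j, a j * pairing (pderiv j f) (linearForm v * (linearForm v * linearForm a ^ d))
      = 0 := by
    have : pairing f (linearForm a * (linearForm v * (linearForm v * linearForm a ^ d))) = 0 := by
      have e : linearForm a * (linearForm v * (linearForm v * linearForm a ^ d))
          = linearForm v * (linearForm a ^ (d + 1) * linearForm v) := by ring
      rw [e, pairing_apply, diffOp_mul_apply, hv, map_zero, coeff_zero]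
    rw [pairing_linearForm_mul] at this
    simpa only [pairing_X_mul] using this
  have hterm : ∀ j, a j *
      pairing (pderiv j f) (linearForm v * (linearForm v * linearForm a ^ d)) ≤ 0 := by
    intro j
    rcases (ha j).eq_or_lt with h0 | h0
    · rw [← h0, zero_mul]
    · rcases hs j h0 with h | h
      · rw [h, pairing_zero_left, mul_zero]
      · exact mul_nonpos_of_nonneg_of_nonpos h0.le (h.nonpos (hprim j))
  have hz := (Finset.sum_eq_zero_iff_of_nonpos fun j _ => hterm j).1 hsum i (Finset.mem_univ i)
  rcases hs i hi with h | h
  · rw [h, map_zero]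
  · exact h.diffOp_eq_zero hf.pderiv (hprim i) ((mul_eq_zero.1 hz).resolve_left hi.ne')

/-- Local-to-global step for the Hodge index inequality: the inequalities of the partial
derivatives, summed with weights `aᵢ`, bound the random walk operator of the Hessian of
`∂_a ^ (d + 1) f` by its square. The variable `o` connects the graph of nonzero entries. -/
theorem HodgeIndexAt.of_pderiv {f : MvPolynomial σ ℝ} {d : ℕ} {a : σ → ℝ} (ha : ∀ i, 0 < a i)
    (pos : 0 < pairing f (linearForm a ^ (d + 1 + 2)))
    (hnn : ∀ i j, 0 ≤ pairing f (X i * (X j * linearForm a ^ (d + 1)))) (o : σ)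
    (ho : ∀ i, pderiv i f = 0 ∨ 0 < pairing f (X o * (X i * linearForm a ^ (d + 1))))
    (hd : ∀ i, pderiv i f = 0 ∨ HodgeIndexAt (pderiv i f) d a) : HodgeIndexAt f (d + 1) a := by
  classical
  -- in the coordinates `y i = v i / a i` the form becomes the transition form of a random walk
  let W : Matrix σ σ ℝ := Matrix.of fun i j =>
    a i * (a j * pairing f (X i * (X j * linearForm a ^ (d + 1))))
  have hWv : ∀ (v : σ → ℝ) i, (W.mulVec fun j => v j / a j) i
      = a i * pairing f (X i * (linearForm v * linearForm a ^ (d + 1))) := by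
    intro v i
    rw [mul_left_comm, pairing_linearForm_mul, Finset.mul_sum]
    refine Finset.sum_congr rfl fun j _ => ?_
    have := (ha j).ne'
    simp only [W, Matrix.of_apply]
    rw [mul_left_comm (X j)]
    field_simp
  have hWw : ∀ i, ∑ j, W i j = a i * pairing f (X i * linearForm a ^ (d + 2)) := by
    intro i
    have h1 := hWv a i
    rw [← pow_succ'] at h1
    rw [← h1]
    refine Finset.sum_congr rfl fun j _ => ?_
    change W i j = W i j * (a j / a j)
    rw [div_self (ha j).ne', mul_one]
  have hWq : ∀ v : σ → ℝ, (fun j => v j / a j) ⬝ᵥ W.mulVec (fun j => v j / a j)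
      = pairing f (linearForm v * (linearForm v * linearForm a ^ (d + 1))) := by
    intro v
    rw [pairing_linearForm_mul]
    refine Finset.sum_congr rfl fun i _ => ?_
    have := (ha i).ne'
    rw [hWv]
    field_simp
  have hWle : ∀ y, y ⬝ᵥ W.mulVec y ≤ ∑ i, (W.mulVec y) i ^ 2 / ∑ j, W i j := by
    intro y
    obtain ⟨v, rfl⟩ : ∃ v : σ → ℝ, y = fun j => v j / a j :=
      ⟨fun j => y j * a j, funext fun j => by rw [mul_div_cancel_right₀ _ (ha j).ne']⟩
    rw [hWq]
    have e : linearForm v * (linearForm v * linearForm a ^ (d + 1))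
        = linearForm a * (linearForm v * (linearForm v * linearForm a ^ d)) := by ring
    rw [e, pairing_linearForm_mul]
    refine Finset.sum_le_sum fun i _ => ?_
    rw [hWw, hWv]
    simp only [pairing_X_mul]
    rcases hd i with h | h
    · simp [h, pairing_zero_left]
    · have h1 := h.le_sq v
      have h2 := h.pos
      have h3 := ha i
      rw [le_div_iff₀ (by positivity)]
      nlinarith [mul_le_mul_of_nonneg_left h1 (sq_nonneg (a i))]
  refine HodgeIndexAt.of_linearMap pos
    (hodgeForm f (linearForm a ^ (d + 1)) a) fun v hv => ?_
  rw [hodgeForm_comm, hodgeForm_pow_apply, pairing_linearForm_mul] at hv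
  rw [← hWq]
  refine dotProduct_mulVec_nonpos_of_le_sum_sq_div W (fun i j => ?_) (fun i j => ?_) o
    (fun i hi => ?_) hWle ?_
  · simp only [W, Matrix.of_apply]
    rw [mul_left_comm (X i)]
    ring
  · exact mul_nonneg (ha i).le (mul_nonneg (ha j).le (hnn i j))
  · rcases ho i with h | h
    · rw [hWw, pairing_X_mul, h, pairing_zero_left, mul_zero]
    · exact absurd hi (mul_pos (ha o) (mul_pos (ha i) h)).ne'
  · rw [← hv]
    refine Finset.sum_congr rfl fun i _ => ?_
    have := (ha i).ne'
    rw [hWw]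
    field_simp

/-- The Hodge index inequality is a closed condition on `a`, apart from positivity. -/
theorem HodgeIndexAt.of_forall_pos {f : MvPolynomial σ ℝ} {d : ℕ} {a b : σ → ℝ}
    (pos : 0 < pairing f (linearForm a ^ (d + 2)))
    (h : ∀ t : ℝ, 0 < t → HodgeIndexAt f d (a + t • b)) : HodgeIndexAt f d a where
  pos := pos
  le_sq v := by
    have hc := continuous_pairing_mul_pow f (linearForm a) (linearForm b)
    have h1 := hc d (linearForm v * linearForm v)
    have h2 := hc (d + 2) 1
    have h3 := hc (d + 1) (linearForm v)
    have hle : ∀ t ∈ Set.Ioi (0 : ℝ), _ ≤ _ := fun t ht => (h t ht).le_sq v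
    have h0 : (0 : ℝ) ∈ closure (Set.Ioi (0 : ℝ)) := by
      rw [closure_Ioi]; exact Set.self_mem_Ici
    have hcl := closure_minimal (s := Set.Ioi (0 : ℝ))
      (t := {t | pairing f (linearForm v * linearForm v *
          (linearForm a + t • linearForm b) ^ d) *
        pairing f (1 * (linearForm a + t • linearForm b) ^ (d + 2)) ≤
        pairing f (linearForm v * (linearForm a + t • linearForm b) ^ (d + 1)) ^ 2})
      (fun t ht => by
        have := hle t ht
        simpa only [map_add, map_smul, mul_assoc, one_mul, Set.mem_ofPred_eq] using this)
      (isClosed_le (h1.mul h2) (h3.pow 2)) h0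
    simpa [mul_assoc] using hcl

end Pairing

/-! ### From the strict Hodge index inequality to the Hodge-Riemann relation -/

section HodgeRiemannRelation

variable {σ : Type*}

theorem toR_eq_zero_iff {f D : MvPolynomial σ ℝ} : toR f D = 0 ↔ diffOp D f = 0 := by
  rw [Ideal.Quotient.mkₐ_eq_mk, Ideal.Quotient.eq_zero_iff_mem, mem_annIdeal]

theorem mem_gradedPiece {f : MvPolynomial σ ℝ} {k : ℕ} {ξ : GorensteinAlg f} :
    ξ ∈ gradedPiece f k ↔ ∃ D : MvPolynomial σ ℝ, D.IsHomogeneous k ∧ toR f D = ξ := by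
  simp [gradedPiece, Submodule.mem_map]

variable [Fintype σ]

/-- If `ℓ_a ^ d` is injective on `R_f^1`, it maps `R_f^1` onto `R_f^{d+1}`: by Gorenstein duality
it is its own transpose. -/
theorem StrictHodgeIndexAt.exists_diffOp_eq {f : MvPolynomial σ ℝ} {d : ℕ} {a : σ → ℝ}
    (h : StrictHodgeIndexAt f d a) (hf : f.IsHomogeneous (d + 2)) {E : MvPolynomial σ ℝ}
    (hE : E.IsHomogeneous (d + 1)) :
    ∃ v, diffOp (linearForm a ^ d * linearForm v) f = diffOp E f := by
  classical
  have hhom : ∀ v, (linearForm a ^ d * linearForm v).IsHomogeneous (d + 1) := fun v => by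
    simpa using ((isHomogeneous_linearForm a).pow d).mul (isHomogeneous_linearForm v)
  let B := hodgeForm f (linearForm a ^ d)
  let φ : Module.Dual ℝ (σ → ℝ) :=
    pairing f ∘ₗ LinearMap.mulRight ℝ E ∘ₗ linearForm
  have hφ : φ ∈ (LinearMap.ker B).dualAnnihilator := by
    rw [Submodule.mem_dualAnnihilator]
    intro w hw
    have h1 : diffOp (linearForm w) f = 0 := by
      refine h.inj w (diffOp_eq_zero_of_forall_pairing_X_mul hf (hhom w) fun i => ?_)
      have h2 : B w (Pi.single i 1) = 0 := by
        rw [LinearMap.mem_ker.1 hw, LinearMap.zero_apply]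
      rw [hodgeForm_comm, hodgeForm_apply, linearForm_single] at h2
      rw [← h2, mul_comm (linearForm w)]
    change pairing f (linearForm w * E) = 0
    rw [pairing_mul, h1, pairing_zero_left]
  rw [← LinearMap.range_dualMap_eq_dualAnnihilator_ker] at hφ
  obtain ⟨ψ, hψ⟩ := hφ
  obtain ⟨v, rfl⟩ := (Module.evalEquiv ℝ (σ → ℝ)).surjective ψ
  have hv : ∀ w, B w v = pairing f (linearForm w * E) := fun w => LinearMap.congr_fun hψ w
  refine ⟨v, ?_⟩
  rw [← sub_eq_zero, ← LinearMap.sub_apply, ← map_sub]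
  refine diffOp_eq_zero_of_forall_pairing_X_mul hf ((hhom v).sub hE) fun i => ?_
  have h3 := hv (Pi.single i 1)
  rw [hodgeForm_apply, linearForm_single] at h3
  rw [mul_sub, map_sub, ← h3, mul_comm (linearForm v), sub_self]

theorem StrictHodgeIndexAt.hasHRR_one {f : MvPolynomial σ ℝ} {d : ℕ} {a : σ → ℝ}
    (h : StrictHodgeIndexAt f d a) (hf : f.IsHomogeneous (d + 2)) :
    HasHRR f 1 (linearForm a) := by
  have hne : f ≠ 0 := by
    rintro rfl
    have := h.pos
    rw [pairing_zero_left] at this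
    exact this.false
  have hdeg : f.totalDegree = d + 2 := hf.totalDegree hne
  have e1 : f.totalDegree - 2 * 1 = d := by omega
  have e2 : f.totalDegree - 1 = d + 1 := by omega
  have e3 : f.totalDegree + 1 - 2 * 1 = d + 1 := by omega
  refine ⟨⟨hdeg ▸ hf, by omega, isHomogeneous_linearForm a, ?_⟩, ?_⟩
  · rw [e1, e2]
    refine ⟨fun ξ hξ => ?_, fun ξ₁ hξ₁ ξ₂ hξ₂ heq => ?_, fun η hη => ?_⟩
    · obtain ⟨p, hp, rfl⟩ := mem_gradedPiece.1 hξ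
      refine mem_gradedPiece.2 ⟨linearForm a ^ d * p, ?_, by rw [map_mul, map_pow]⟩
      simpa using ((isHomogeneous_linearForm a).pow d).mul hp
    · obtain ⟨p, hp, hpξ⟩ := mem_gradedPiece.1 (Submodule.sub_mem _ hξ₁ hξ₂)
      obtain ⟨v, rfl⟩ := exists_linearForm_eq hp
      rw [← sub_eq_zero, ← hpξ, toR_eq_zero_iff]
      refine h.inj v ?_
      rw [← toR_eq_zero_iff, map_mul, map_pow, hpξ, mul_sub, sub_eq_zero]
      exact heq
    · obtain ⟨E, hE, rfl⟩ := mem_gradedPiece.1 hη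
      obtain ⟨v, hv⟩ := h.exists_diffOp_eq hf hE
      refine ⟨toR f (linearForm v), mem_gradedPiece.2 ⟨_, isHomogeneous_linearForm v, rfl⟩, ?_⟩
      change toR f (linearForm a) ^ d * toR f (linearForm v) = toR f E
      rw [← map_pow, ← map_mul, ← sub_eq_zero, ← map_sub, toR_eq_zero_iff, map_sub,
        LinearMap.sub_apply, hv, sub_self]
  · intro ξ hξ hprim hξ0
    obtain ⟨p, hp, rfl⟩ := mem_gradedPiece.1 hξ
    obtain ⟨v, rfl⟩ := exists_linearForm_eq hp
    rw [e3, ← map_pow, ← map_mul, toR_eq_zero_iff] at hprim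
    have hv : pairing f (linearForm v * linearForm a ^ (d + 1)) = 0 := by
      rw [mul_comm, pairing_apply, hprim, coeff_zero]
    have hlt := lt_of_le_of_ne (h.nonpos hv) fun h0 =>
      hξ0 (toR_eq_zero_iff.2 (h.diffOp_eq_zero hf hv h0))
    have hform : hrForm f 1 (linearForm a) (toR f (linearForm v)) (toR f (linearForm v))
        = -pairing f (linearForm v * (linearForm v * linearForm a ^ d)) := by
      rw [hrForm, e1, ← map_pow, ← map_mul, ← map_mul, degMap_toR, ← pairing_apply, pow_one,
        neg_one_mul, mul_right_comm, mul_assoc]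
    rw [hform]
    linarith

end HodgeRiemannRelation

/-! ### Independent set polynomials under differentiation -/

section IndepPoly

variable {n : ℕ}

open Classical in
/-- The polynomial `(∂/∂x₀)^k ∑_{I independent} x₀^(r + k - |I|) ∏_{i ∈ I} xᵢ`. For a matroid with
at most `r + k` elements this is homogeneous of degree `r`. The number `r + k` need not be the size
of `Fin n`, because the ground set of a contraction, as a matroid on `Fin n`, is a smaller subset
of `Fin n`. -/
noncomputable def genIndepPoly (r k : ℕ) (M : Matroid (Fin n)) : MvPolynomial (Fin (n + 1)) ℝ :=
  (pderiv 0)^[k] (∑ I ∈ Finset.univ.filter (fun I : Finset (Fin n) => M.Indep (I : Set (Fin n))),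
    (∏ i ∈ I, X i.succ) * X 0 ^ (r + k - I.card))

theorem pderiv_prod_X_eq_zero {σ ι : Type*} (s : σ) (g : ι → σ) (I : Finset ι)
    (h : ∀ i ∈ I, g i ≠ s) : pderiv s (∏ i ∈ I, (X (g i) : MvPolynomial σ ℝ)) = 0 := by
  classical
  induction I using Finset.induction_on with
  | empty => simp
  | insert i I hi ih =>
    rw [Finset.prod_insert hi, pderiv_mul, ih fun j hj => h j (Finset.mem_insert_of_mem hj),
      pderiv_X_of_ne (h i (Finset.mem_insert_self i I)), mul_zero, zero_mul, add_zero]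

theorem iterate_pderiv_sum {σ ι : Type*} (s : σ) (k : ℕ) (T : Finset ι)
    (g : ι → MvPolynomial σ ℝ) :
    (pderiv s)^[k] (∑ i ∈ T, g i) = ∑ i ∈ T, (pderiv s)^[k] (g i) := by
  induction k with
  | zero => rfl
  | succ k ih => simp only [Function.iterate_succ_apply', ih, map_sum]

theorem iterate_pderiv_mul_X_pow {σ : Type*} {s : σ} {q : MvPolynomial σ ℝ}
    (hq : pderiv s q = 0) (k m : ℕ) :
    (pderiv s)^[k] (q * X s ^ m) = (m.descFactorial k : ℝ) • (q * X s ^ (m - k)) := by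
  induction k with
  | zero => simp
  | succ k ih =>
    rw [Function.iterate_succ_apply', ih, Derivation.map_smul, pderiv_mul, hq, pderiv_pow, pderiv_X_self,
      zero_mul, zero_add, mul_one, Nat.descFactorial_succ, Nat.sub_sub]
    simp only [smul_eq_C_mul, Nat.cast_mul, C_mul, map_natCast]
    ring

theorem iterate_pderiv_comm {σ : Type*} (s t : σ) (k : ℕ) (p : MvPolynomial σ ℝ) :
    pderiv t ((pderiv s)^[k] p) = (pderiv s)^[k] (pderiv t p) := by
  induction k with
  | zero => rfl
  | succ k ih => rw [Function.iterate_succ_apply', pderiv_comm, ih, Function.iterate_succ_apply']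

theorem pderiv_zero_genIndepPoly (r k : ℕ) (M : Matroid (Fin n)) :
    pderiv 0 (genIndepPoly (r + 1) k M) = genIndepPoly r (k + 1) M := by
  rw [genIndepPoly, genIndepPoly, Function.iterate_succ_apply', add_right_comm, add_assoc]

theorem pderiv_succ_prod_mul {i : Fin n} (I : Finset (Fin n)) (m : ℕ) :
    pderiv i.succ ((∏ j ∈ I, X j.succ) * X 0 ^ m : MvPolynomial (Fin (n + 1)) ℝ)
      = if i ∈ I then (∏ j ∈ I.erase i, X j.succ) * X 0 ^ m else 0 := by
  have h0 : pderiv i.succ (X 0 ^ m : MvPolynomial (Fin (n + 1)) ℝ) = 0 := by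
    rw [pderiv_pow, pderiv_X_of_ne (Fin.succ_ne_zero i).symm, mul_zero]
  have h1 : ∀ J : Finset (Fin n), i ∉ J →
      pderiv i.succ (∏ j ∈ J, X j.succ : MvPolynomial (Fin (n + 1)) ℝ) = 0 := fun J hJ =>
    pderiv_prod_X_eq_zero _ _ _ fun j hj h => hJ (Fin.succ_injective n h ▸ hj)
  rw [pderiv_mul, h0, mul_zero, add_zero]
  split_ifs with hi
  · rw [← Finset.mul_prod_erase I _ hi, pderiv_mul, pderiv_X_self,
      h1 _ (Finset.notMem_erase i I), mul_zero, add_zero, one_mul]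
  · rw [h1 I hi, zero_mul]

theorem pderiv_succ_genIndepPoly_of_not_isNonloop (r k : ℕ) {M : Matroid (Fin n)} {i : Fin n}
    (hi : ¬ M.IsNonloop i) : pderiv i.succ (genIndepPoly r k M) = 0 := by
  classical
  rw [genIndepPoly, iterate_pderiv_comm, map_sum, Finset.sum_eq_zero]
  · induction k with
    | zero => rfl
    | succ k ih => rw [Function.iterate_succ_apply', ih, map_zero]
  · intro I hI
    rw [pderiv_succ_prod_mul, if_neg]
    exact fun h => hi ((Finset.mem_filter.1 hI).2.isNonloop_of_mem (Finset.mem_coe.2 h))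

theorem pderiv_succ_genIndepPoly (r k : ℕ) {M : Matroid (Fin n)} {i : Fin n}
    (hi : M.IsNonloop i) :
    pderiv i.succ (genIndepPoly (r + 1) k M) = genIndepPoly r k (M ／ {i}) := by
  classical
  rw [genIndepPoly, genIndepPoly, iterate_pderiv_comm, map_sum]
  congr 1
  simp only [pderiv_succ_prod_mul]
  rw [← Finset.sum_filter, Finset.filter_filter]
  refine Finset.sum_bij' (fun I _ => I.erase i) (fun J _ => insert i J) ?_ ?_ ?_ ?_ ?_
  · intro I hI
    simp only [Finset.mem_filter, Finset.mem_univ, true_and] at hI ⊢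
    rw [hi.contractElem_indep_iff]
    refine ⟨by simp, ?_⟩
    rw [← Finset.coe_insert, Finset.insert_erase hI.2]
    exact hI.1
  · intro J hJ
    simp only [Finset.mem_filter, Finset.mem_univ, true_and] at hJ ⊢
    rw [hi.contractElem_indep_iff] at hJ
    exact ⟨by rw [Finset.coe_insert]; exact hJ.2, Finset.mem_insert_self i J⟩
  · intro I hI
    exact Finset.insert_erase (Finset.mem_filter.1 hI).2.2
  · intro J hJ
    simp only [Finset.mem_filter, Finset.mem_univ, true_and] at hJ
    rw [hi.contractElem_indep_iff] at hJ
    exact Finset.erase_insert (by simpa using hJ.1)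
  · intro I hI
    have h := (Finset.mem_filter.1 hI).2.2
    have h1 := Finset.card_pos.2 ⟨i, h⟩
    rw [Finset.card_erase_of_mem h]
    congr 2
    omega

theorem isHomogeneous_genIndepPoly {r k : ℕ} {M : Matroid (Fin n)} (hM : M.E.ncard ≤ r + k) :
    (genIndepPoly r k M).IsHomogeneous r := by
  classical
  have h1 : ∀ (j : ℕ) (p : MvPolynomial (Fin (n + 1)) ℝ) (m : ℕ), p.IsHomogeneous m →
      ((pderiv 0)^[j] p).IsHomogeneous (m - j) := by
    intro j
    induction j with
    | zero => exact fun p m hp => hp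
    | succ j ih =>
      intro p m hp
      rw [Function.iterate_succ_apply', ← Nat.sub_sub]
      exact (ih p m hp).pderiv
  have h2 := h1 k _ (r + k) (IsHomogeneous.sum
    (Finset.univ.filter (fun I : Finset (Fin n) => M.Indep (I : Set (Fin n))))
    (fun I => (∏ i ∈ I, X i.succ) * X 0 ^ (r + k - I.card)) (r + k) fun I hI => ?_)
  · rw [Nat.add_sub_cancel] at h2
    exact h2
  · have hc : I.card ≤ r + k := by
      refine le_trans ?_ hM
      rw [← Set.ncard_coe_finset]
      exact Set.ncard_le_ncard (Finset.mem_filter.1 hI).2.subset_ground (Set.toFinite _)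
    have h3 := (IsHomogeneous.prod I (fun i => (X i.succ : MvPolynomial (Fin (n + 1)) ℝ))
      (fun _ => 1) fun i _ => isHomogeneous_X ℝ _).mul
      (isHomogeneous_X_pow (R := ℝ) (0 : Fin (n + 1)) (r + k - I.card))
    rw [Finset.sum_const, smul_eq_mul, mul_one, Nat.add_sub_cancel' hc] at h3
    exact h3

/-- The only independent set that contributes in degree zero is the empty one. -/
theorem pairing_genIndepPoly_zero (k : ℕ) (M : Matroid (Fin n)) :
    pairing (genIndepPoly 0 k M) 1 = k.factorial := by
  classical
  rw [pairing_apply, map_one, Module.End.one_apply, genIndepPoly, iterate_pderiv_sum, coeff_sum,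
    Finset.sum_eq_single ∅]
  · rw [iterate_pderiv_mul_X_pow (by simp)]
    simp [Nat.descFactorial_self]
  · intro I _ hI
    obtain ⟨i, hi⟩ := Finset.nonempty_iff_ne_empty.2 hI
    rw [iterate_pderiv_mul_X_pow
      (pderiv_prod_X_eq_zero _ _ _ fun j _ => Fin.succ_ne_zero j), coeff_smul,
      ← constantCoeff_eq, map_mul, map_prod, Finset.prod_eq_zero hi (constantCoeff_X ℝ i.succ),
      zero_mul, smul_zero]
  · intro h
    exact absurd (by simp) h

theorem ncard_ground_contractElem {M : Matroid (Fin n)} {i : Fin n} (hi : M.IsNonloop i) :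
    (M ／ {i}).E.ncard + 1 = M.E.ncard := by
  rw [Matroid.contract_ground]
  exact Set.ncard_sdiff_singleton_add_one hi.mem_ground (Set.toFinite _)

/-- Every partial derivative of a member of the family vanishes or is again a member of it. -/
theorem pderiv_genIndepPoly_eq (r k : ℕ) (M : Matroid (Fin n)) (s : Fin (n + 1)) :
    pderiv s (genIndepPoly (r + 1) k M) = 0 ∨ ∃ k' M',
      pderiv s (genIndepPoly (r + 1) k M) = genIndepPoly r k' M' ∧
      (M.E.ncard ≤ r + 1 + k → M'.E.ncard ≤ r + k') := by
  refine Fin.cases ?_ (fun i => ?_) s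
  · exact Or.inr ⟨k + 1, M, pderiv_zero_genIndepPoly r k M, fun h => by omega⟩
  · by_cases hi : M.IsNonloop i
    · have := ncard_ground_contractElem hi
      exact Or.inr ⟨k, M ／ {i}, pderiv_succ_genIndepPoly r k hi, fun h => by omega⟩
    · exact Or.inl (pderiv_succ_genIndepPoly_of_not_isNonloop _ k hi)

theorem pairing_genIndepPoly_nonneg {a : Fin (n + 1) → ℝ} (ha : ∀ s, 0 ≤ a s) (r : ℕ) :
    ∀ k (M : Matroid (Fin n)), 0 ≤ pairing (genIndepPoly r k M) (linearForm a ^ r) := by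
  induction r with
  | zero => intro k M; rw [pow_zero, pairing_genIndepPoly_zero]; positivity
  | succ r ih =>
    intro k M
    rw [pow_succ', pairing_linearForm_mul]
    refine Finset.sum_nonneg fun s _ => mul_nonneg (ha s) ?_
    rw [pairing_X_mul]
    rcases pderiv_genIndepPoly_eq r k M s with h | ⟨k', M', h, -⟩
    · rw [h, pairing_zero_left]
    · rw [h]; exact ih k' M'

theorem le_pairing_genIndepPoly_succ {a : Fin (n + 1) → ℝ} (ha : ∀ s, 0 ≤ a s) (r k : ℕ)
    (M : Matroid (Fin n)) (s : Fin (n + 1)) :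
    a s * pairing (pderiv s (genIndepPoly (r + 1) k M)) (linearForm a ^ r)
      ≤ pairing (genIndepPoly (r + 1) k M) (linearForm a ^ (r + 1)) := by
  rw [pow_succ' _ r, pairing_linearForm_mul, ← pairing_X_mul]
  refine Finset.single_le_sum (f := fun s =>
    a s * pairing (genIndepPoly (r + 1) k M) (X s * linearForm a ^ r)) (fun s _ => ?_)
    (Finset.mem_univ s)
  refine mul_nonneg (ha s) ?_
  rw [pairing_X_mul]
  rcases pderiv_genIndepPoly_eq r k M s with h | ⟨k', M', h, -⟩
  · rw [h, pairing_zero_left]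
  · rw [h]; exact pairing_genIndepPoly_nonneg ha r k' M'

theorem pairing_genIndepPoly_pos {a : Fin (n + 1) → ℝ} (ha : ∀ s, 0 ≤ a s) (ha0 : 0 < a 0)
    (r : ℕ) : ∀ k (M : Matroid (Fin n)), 0 < pairing (genIndepPoly r k M) (linearForm a ^ r) := by
  induction r with
  | zero => intro k M; rw [pow_zero, pairing_genIndepPoly_zero]; positivity
  | succ r ih =>
    intro k M
    refine lt_of_lt_of_le ?_ (le_pairing_genIndepPoly_succ ha r k M 0)
    rw [pderiv_zero_genIndepPoly]
    exact mul_pos ha0 (ih (k + 1) M)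

theorem succ_le_ncard_of_isBase_contractElem {M : Matroid (Fin n)} {r : ℕ}
    (hM : ∀ B, M.IsBase B → r + 1 ≤ B.ncard) {i : Fin n} (hi : M.IsNonloop i) (B : Set (Fin n))
    (hB : (M ／ {i}).IsBase B) : r ≤ B.ncard := by
  rw [(Matroid.indep_singleton.2 hi).contract_isBase_iff] at hB
  have h1 := hM _ hB.1
  have h2 := Set.ncard_union_le B {i}
  rw [Set.ncard_singleton] at h2
  omega

/-- Positivity when `a 0` may vanish: the monomials of the bases contribute. The hypothesis bounds
the rank of `M` from below. -/
theorem pairing_genIndepPoly_pos_of_isBase {a : Fin (n + 1) → ℝ} (ha : ∀ s, 0 ≤ a s)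
    (ha' : ∀ i : Fin n, 0 < a i.succ) (r : ℕ) :
    ∀ k (M : Matroid (Fin n)), (∀ B, M.IsBase B → r ≤ B.ncard) →
      0 < pairing (genIndepPoly r k M) (linearForm a ^ r) := by
  induction r with
  | zero => intro k M _; rw [pow_zero, pairing_genIndepPoly_zero]; positivity
  | succ r ih =>
    intro k M hM
    obtain ⟨B, hB⟩ := M.exists_isBase
    have h1 := hM B hB
    obtain ⟨i, hiB⟩ : B.Nonempty := by
      rw [Set.nonempty_iff_ne_empty]
      rintro rfl
      simp at h1
    have hi := hB.indep.isNonloop_of_mem hiB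
    refine lt_of_lt_of_le ?_ (le_pairing_genIndepPoly_succ ha r k M i.succ)
    rw [pderiv_succ_genIndepPoly r k hi]
    exact mul_pos (ha' i) (ih k _ (succ_le_ncard_of_isBase_contractElem hM hi))

/-- Differentiating with respect to `x₀` only changes the parameters `r` and `k`; for the reduced
polynomial it corresponds to truncation of the matroid. -/
theorem pairing_genIndepPoly_X_zero_pow_mul (r m : ℕ) (M : Matroid (Fin n))
    (D : MvPolynomial (Fin (n + 1)) ℝ) : ∀ k,
    pairing (genIndepPoly (r + m) k M) (X 0 ^ m * D) = pairing (genIndepPoly r (k + m) M) D := by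
  induction m with
  | zero => intro k; simp
  | succ m ih =>
    intro k
    rw [pow_succ', mul_assoc, pairing_X_mul, ← add_assoc, pderiv_zero_genIndepPoly, ih]
    congr 3
    omega

end IndepPoly

/-! ### Parallel classes -/

section ParallelClasses

/-- Cauchy-Schwarz for the sums of `w` over the fibres of `c`, of which there are at most
`T.card`. -/
theorem sum_sq_le_card_mul_sum_fiber {α β : Type*} [DecidableEq β] (T : Finset α) (c : α → β)
    (w : α → ℝ) : (∑ i ∈ T, w i) ^ 2 ≤ T.card * ∑ i ∈ T, w i * ∑ j ∈ T with c j = c i, w j := by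
  have h1 : ∑ i ∈ T, w i = ∑ P ∈ T.image c, ∑ i ∈ T with c i = P, w i :=
    (Finset.sum_fiberwise_of_maps_to (fun i hi => Finset.mem_image_of_mem c hi) _).symm
  have h2 : ∑ i ∈ T, w i * ∑ j ∈ T with c j = c i, w j
      = ∑ P ∈ T.image c, (∑ i ∈ T with c i = P, w i) ^ 2 := by
    rw [← Finset.sum_fiberwise_of_maps_to (fun i hi => Finset.mem_image_of_mem c hi)]
    refine Finset.sum_congr rfl fun P _ => ?_
    rw [sq, Finset.sum_mul]
    refine Finset.sum_congr rfl fun i hi => ?_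
    rw [(Finset.mem_filter.1 hi).2]
  rw [h1, h2]
  refine sq_sum_le_card_mul_sum_sq.trans (mul_le_mul_of_nonneg_right ?_ ?_)
  · exact_mod_cast Finset.card_image_le
  · exact Finset.sum_nonneg fun P _ => sq_nonneg _

theorem sum_eq_card_image_mul {α β : Type*} [DecidableEq β] (T : Finset α) (c : α → β)
    (w : α → ℝ) {t : ℝ} (h : ∀ i ∈ T, ∑ j ∈ T with c j = c i, w j = t) :
    ∑ i ∈ T, w i = (T.image c).card * t := by
  rw [← Finset.sum_fiberwise_of_maps_to (fun i hi => Finset.mem_image_of_mem c hi),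
    Finset.sum_congr rfl (g := fun _ => t), Finset.sum_const, nsmul_eq_mul]
  intro P hP
  obtain ⟨i, hi, rfl⟩ := Finset.mem_image.1 hP
  exact h i hi

variable {n : ℕ} {M : Matroid (Fin n)}

open Classical in
/-- The non-loops of a matroid on `Fin n`, as a finset. -/
noncomputable def nonloops (M : Matroid (Fin n)) : Finset (Fin n) :=
  Finset.univ.filter fun i => M.IsNonloop i

theorem mem_nonloops {i : Fin n} : i ∈ nonloops M ↔ M.IsNonloop i := by
  simp [nonloops]

theorem card_nonloops_le (M : Matroid (Fin n)) : (nonloops M).card ≤ M.E.ncard := by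
  rw [← Set.ncard_coe_finset]
  exact Set.ncard_le_ncard (fun i hi => (mem_nonloops.1 hi).mem_ground) (Set.toFinite _)

open Classical in
theorem sum_nonloops_eq (M : Matroid (Fin n)) (g : Fin n → ℝ) :
    ∑ i ∈ nonloops M, g i = ∑ i, if M.IsNonloop i then g i else 0 :=
  Finset.sum_filter _ _

open Classical in
theorem sum_nonloops_contract (M : Matroid (Fin n)) (A : Set (Fin n)) (w : Fin n → ℝ) :
    ∑ j ∈ nonloops (M ／ A), w j
      = ∑ j ∈ nonloops M, w j - ∑ j ∈ nonloops M with j ∈ M.closure A, w j := by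
  rw [eq_sub_iff_add_eq, ← Finset.sum_filter_add_sum_filter_not (nonloops M)
    (fun j => j ∈ M.closure A), add_comm]
  congr 1
  refine Finset.sum_congr (Finset.ext fun j => ?_) fun _ _ => rfl
  rw [Finset.mem_filter, mem_nonloops, mem_nonloops, Matroid.contract_isNonloop_iff]
  refine ⟨fun h => ⟨?_, h.2⟩, fun h => ⟨h.1.mem_ground, h.2⟩⟩
  exact Matroid.IsNonloop.of_contract (Matroid.contract_isNonloop_iff.2 h)

theorem mem_closure_singleton_iff {i j : Fin n} (hj : M.IsNonloop j) :
    j ∈ M.closure {i} ↔ M.closure {j} = M.closure {i} :=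
  ⟨fun h => hj.closure_eq_of_mem_closure h,
    fun h => h ▸ M.mem_closure_of_mem' (Set.mem_singleton j) hj.mem_ground⟩

open Classical in
theorem filter_mem_closure_singleton (i : Fin n) :
    (nonloops M).filter (fun j => j ∈ M.closure {i})
      = (nonloops M).filter (fun j => M.closure {j} = M.closure {i}) :=
  Finset.filter_congr fun _ hj => mem_closure_singleton_iff (mem_nonloops.1 hj)

/-- If all parallel classes have weight `t` then a flat of rank two has weight `m t`, `m` the
number of parallel classes in it. Comparing the weights of the rank one flats, of the rank two
flats and of the whole matroid forces the stated relation. -/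
theorem mul_add_sum_nonloops_eq_zero {N : ℕ} (hN : 2 ≤ N) (hcard : (nonloops M).card ≤ N)
    {v₀ : ℝ} {w : Fin n → ℝ}
    (h1 : ∀ i, M.IsNonloop i → (N - 1) * v₀ + ∑ j ∈ nonloops (M ／ {i}), w j = 0)
    (h2 : ∀ i j, M.IsNonloop i → (M ／ {i}).IsNonloop j →
      (N - 2) * v₀ + ∑ l ∈ nonloops (M ／ {i} ／ {j}), w l = 0)
    {i j : Fin n} (hi : M.IsNonloop i) (hj : (M ／ {i}).IsNonloop j) :
    N * v₀ + ∑ l ∈ nonloops M, w l = 0 := by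
  classical
  have hjM : M.IsNonloop j := hj.of_contract
  set s := ∑ l ∈ nonloops M, w l with hs
  set t := N * v₀ + s - v₀ with ht
  let c : Fin n → Set (Fin n) := fun l => M.closure {l}
  have hclass : ∀ l, M.IsNonloop l → ∑ x ∈ nonloops M with c x = c l, w x = t := by
    intro l hl
    have := h1 l hl
    rw [sum_nonloops_contract, filter_mem_closure_singleton l] at this
    linarith
  have hm : s = ((nonloops M).image c).card * t :=
    sum_eq_card_image_mul _ c w fun l hl => hclass l (mem_nonloops.1 hl)
  -- the non-loops in the flat of rank two spanned by `i` and `j`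
  set F := (nonloops M).filter fun l => l ∈ M.closure ({i} ∪ {j}) with hF
  have hFsum : ∑ l ∈ F, w l = t - v₀ := by
    have := h2 i j hi hj
    rw [Matroid.contract_contract, sum_nonloops_contract] at this
    linarith
  have hFm : ∑ l ∈ F, w l = (F.image c).card * t := by
    refine sum_eq_card_image_mul _ c w fun l hl => ?_
    rw [← hclass l (mem_nonloops.1 (Finset.mem_filter.1 hl).1), hF, Finset.filter_filter]
    refine Finset.sum_congr (Finset.filter_congr fun x hx => ?_) fun _ _ => rfl
    refine ⟨fun h => h.2, fun h => ⟨?_, h⟩⟩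
    have h3 : x ∈ M.closure {l} :=
      (mem_closure_singleton_iff (mem_nonloops.1 hx)).2 h
    exact M.closure_subset_closure_of_subset_closure
      (Set.singleton_subset_iff.2 (Finset.mem_filter.1 hl).2) h3
  have hF2 : 2 ≤ (F.image c).card := by
    have hne : c i ≠ c j := by
      intro h
      rw [Matroid.contract_isNonloop_iff] at hj
      exact hj.2 ((mem_closure_singleton_iff hjM).2 h.symm)
    rw [← Finset.card_pair hne]
    refine Finset.card_le_card fun P hP => ?_
    rw [Finset.mem_insert, Finset.mem_singleton] at hP
    rcases hP with rfl | rfl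
    · exact Finset.mem_image_of_mem c (Finset.mem_filter.2 ⟨mem_nonloops.2 hi,
        M.mem_closure_of_mem' (Or.inl rfl) hi.mem_ground⟩)
    · exact Finset.mem_image_of_mem c (Finset.mem_filter.2 ⟨mem_nonloops.2 hjM,
        M.mem_closure_of_mem' (Or.inr rfl) hjM.mem_ground⟩)
  have hmN : (((nonloops M).image c).card : ℝ) ≤ N := by
    exact_mod_cast Finset.card_image_le.trans hcard
  have hF2' : (2 : ℝ) ≤ (F.image c).card := by exact_mod_cast hF2
  have hN' : (2 : ℝ) ≤ N := by exact_mod_cast hN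
  set m : ℝ := (((nonloops M).image c).card : ℝ)
  set q : ℝ := ((F.image c).card : ℝ)
  have hv : v₀ = (1 - q) * t := by linarith
  have hprod : t * (1 + (N - 1) * (q - 1) - m) = 0 := by
    have : t - (N - 1) * v₀ = m * t := by rw [← hm, ht]; ring
    rw [hv] at this
    linear_combination this
  -- if `t ≠ 0` then `m ≤ N` forces `q = 2`, `m = N` and `v₀ = -t`
  rcases mul_eq_zero.1 hprod with h | h
  · rw [h, mul_zero] at hv
    rw [h, hv] at ht
    linarith
  · have hq : q = 2 := by
      by_contra hne
      have : 2 < q := lt_of_le_of_ne hF2' (Ne.symm hne)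
      nlinarith
    rw [hq] at hv
    linarith

end ParallelClasses

/-! ### The Hodge index inequality for independent set polynomials -/

section HodgeIndex

variable {n : ℕ}

theorem pairing_genIndepPoly_one (k : ℕ) (M : Matroid (Fin n)) (v : Fin (n + 1) → ℝ) :
    pairing (genIndepPoly 1 k M) (linearForm v)
      = k.factorial * ((k + 1) * v 0 + ∑ i ∈ nonloops M, v i.succ) := by
  rw [← mul_one (linearForm v), pairing_linearForm_mul, Fin.sum_univ_succ, pairing_X_mul,
    pderiv_zero_genIndepPoly, pairing_genIndepPoly_zero, Nat.factorial_succ, mul_add,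
    Finset.mul_sum, sum_nonloops_eq]
  congr 1
  · push_cast; ring
  · refine Finset.sum_congr rfl fun i _ => ?_
    rw [pairing_X_mul]
    split_ifs with hi
    · rw [pderiv_succ_genIndepPoly 0 k hi, pairing_genIndepPoly_zero, mul_comm]
    · rw [pderiv_succ_genIndepPoly_of_not_isNonloop 1 k hi, pairing_zero_left, mul_zero]

/-- In degree two, on the hyperplane `N v₀ + ∑ vᵢ = 0` the form is, up to a positive factor,
`s ^ 2 / N - ∑ s_P ^ 2`, where `s_P` is the weight of the parallel class `P` and `s = ∑ s_P`. -/
theorem hodgeIndexAt_genIndepPoly_zero {k : ℕ} {M : Matroid (Fin n)} (hM : M.E.ncard ≤ 2 + k)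
    {a : Fin (n + 1) → ℝ} (ha : ∀ s, 0 < a s) : HodgeIndexAt (genIndepPoly 2 k M) 0 a := by
  classical
  let l : (Fin (n + 1) → ℝ) →ₗ[ℝ] ℝ :=
    ((k : ℝ) + 2) • LinearMap.proj 0 + ∑ i ∈ nonloops M, LinearMap.proj i.succ
  refine HodgeIndexAt.of_linearMap (pairing_genIndepPoly_pos (fun s => (ha s).le) (ha 0) 2 k M) l
    fun w hw => ?_
  have hl : ((k : ℝ) + 2) * w 0 + ∑ i ∈ nonloops M, w i.succ = 0 := by
    simpa [l] using hw
  rw [pow_zero, mul_one, pairing_linearForm_mul, Fin.sum_univ_succ, pairing_X_mul,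
    pderiv_zero_genIndepPoly, pairing_genIndepPoly_one]
  have hi : ∑ i : Fin n, w i.succ * pairing (genIndepPoly 2 k M) (X i.succ * linearForm w)
      = ∑ i ∈ nonloops M, w i.succ * (k.factorial * ((k + 1) * w 0 + (∑ j ∈ nonloops M, w j.succ
        - ∑ j ∈ nonloops M with M.closure {j} = M.closure {i}, w j.succ))) := by
    rw [sum_nonloops_eq M fun i => w i.succ * _]
    refine Finset.sum_congr rfl fun i _ => ?_
    rw [pairing_X_mul]
    split_ifs with hi
    · rw [pderiv_succ_genIndepPoly 1 k hi, pairing_genIndepPoly_one, sum_nonloops_contract,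
        filter_mem_closure_singleton i]
    · rw [pderiv_succ_genIndepPoly_of_not_isNonloop 2 k hi, pairing_zero_left, mul_zero]
  have hi' : ∑ i : Fin n, w i.succ * pairing (genIndepPoly 2 k M) (X i.succ * linearForm w)
      = k.factorial * ((∑ i ∈ nonloops M, w i.succ) *
          ((k + 1) * w 0 + ∑ j ∈ nonloops M, w j.succ)
        - ∑ i ∈ nonloops M, w i.succ *
          ∑ j ∈ nonloops M with M.closure {j} = M.closure {i}, w j.succ) := by
    rw [hi, Finset.sum_mul, ← Finset.sum_sub_distrib, Finset.mul_sum]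
    exact Finset.sum_congr rfl fun i _ => by ring
  rw [hi']
  have hcs := sum_sq_le_card_mul_sum_fiber (nonloops M) (fun j => M.closure {j})
    (fun j => w j.succ)
  set s := ∑ i ∈ nonloops M, w i.succ
  set Q := ∑ i ∈ nonloops M, w i.succ *
    ∑ j ∈ nonloops M with M.closure {j} = M.closure {i}, w j.succ
  have hcard : ((nonloops M).card : ℝ) ≤ k + 2 := by
    have := (card_nonloops_le M).trans hM
    rw [add_comm] at this
    exact_mod_cast this
  have hs : s = -((k + 2) * w 0) := by linarith
  have hQ : ((k : ℝ) + 2) * w 0 ^ 2 ≤ Q := by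
    rcases (nonloops M).eq_empty_or_nonempty with h | h
    · have hs0 : s = 0 := by simp [s, h]
      have hQ0 : Q = 0 := by simp [Q, h]
      have hw0 : w 0 = 0 := by
        have : ((k : ℝ) + 2) * w 0 = 0 := by linarith
        exact (mul_eq_zero.1 this).resolve_left (by positivity)
      rw [hw0, hQ0]; simp
    · have hc : (0 : ℝ) < (nonloops M).card := by exact_mod_cast h.card_pos
      have hQ0 : 0 ≤ Q := by
        by_contra hneg
        nlinarith [sq_nonneg s, mul_pos_of_neg_of_neg (not_le.1 hneg) (neg_lt_zero.2 hc)]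
      have hk : (0 : ℝ) < k + 2 := by positivity
      refine le_of_mul_le_mul_left ?_ hk
      calc ((k : ℝ) + 2) * ((k + 2) * w 0 ^ 2) = s ^ 2 := by rw [hs]; ring
        _ ≤ (nonloops M).card * Q := hcs
        _ ≤ (k + 2) * Q := mul_le_mul_of_nonneg_right hcard hQ0
  have hfin : w 0 * (((k + 1).factorial : ℝ) * (((k + 1 : ℕ) + 1) * w 0 + s))
      + k.factorial * (s * ((k + 1) * w 0 + s) - Q)
      = k.factorial * ((k + 2) * w 0 ^ 2 - Q) := by
    rw [hs]; push_cast; ring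
  rw [hfin]
  exact mul_nonpos_of_nonneg_of_nonpos (by positivity) (by linarith)

/-- For strictly positive `a` the Hodge index inequality passes from the partial derivatives to the
polynomial, with `x₀` as the variable connected to all the others. -/
theorem hodgeIndexAt_genIndepPoly {a : Fin (n + 1) → ℝ} (ha : ∀ s, 0 < a s) (d : ℕ) :
    ∀ k (M : Matroid (Fin n)), M.E.ncard ≤ d + 2 + k →
      HodgeIndexAt (genIndepPoly (d + 2) k M) d a := by
  have ha' : ∀ s, 0 ≤ a s := fun s => (ha s).le
  induction d with
  | zero => exact fun k M hM => hodgeIndexAt_genIndepPoly_zero (by omega) ha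
  | succ d ih =>
    intro k M hM
    refine HodgeIndexAt.of_pderiv ha (pairing_genIndepPoly_pos ha' (ha 0) _ k M) (fun i j => ?_) 0
      (fun i => ?_) (fun i => ?_)
    · rw [pairing_X_mul, pairing_X_mul]
      rcases pderiv_genIndepPoly_eq (d + 2) k M i with h | ⟨k', M', h, -⟩
      · rw [h, map_zero, pairing_zero_left]
      · rw [h]
        rcases pderiv_genIndepPoly_eq (d + 1) k' M' j with h' | ⟨k₂, M₂, h', -⟩
        · rw [h', pairing_zero_left]
        · rw [h']; exact pairing_genIndepPoly_nonneg ha' _ _ _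
    · refine (pderiv_genIndepPoly_eq (d + 2) k M i).imp id ?_
      rintro ⟨k', M', h, -⟩
      rw [pairing_X_mul, pairing_X_mul, pderiv_comm, h, pderiv_zero_genIndepPoly]
      exact pairing_genIndepPoly_pos ha' (ha 0) _ _ _
    · refine (pderiv_genIndepPoly_eq (d + 2) k M i).imp id ?_
      rintro ⟨k', M', h, hM'⟩
      rw [h]
      exact ih k' M' (hM' hM)

theorem eq_zero_of_pderiv_succ_eq_zero (m : ℕ) :
    ∀ g : MvPolynomial (Fin (n + 1)) ℝ, g.IsHomogeneous m → (∀ i : Fin n, pderiv i.succ g = 0) →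
      pairing g (X 0 ^ m) = 0 → g = 0 := by
  induction m with
  | zero =>
    intro g hg _ h
    rw [pow_zero, pairing_apply, map_one, Module.End.one_apply] at h
    rw [eq_C_coeff_zero_of_isHomogeneous_zero hg, h, C_0]
  | succ m ih =>
    intro g hg hs h
    refine eq_zero_of_forall_pderiv_eq_zero hg (Fin.cases ?_ hs)
    refine ih _ hg.pderiv (fun i => ?_) ?_
    · rw [pderiv_comm, hs, map_zero]
    · rw [← pairing_X_mul, ← pow_succ', h]

/-- The vanishing of `∂_v ∂ᵢ f` for all elements `i` of the ground set already gives `∂_v f = 0`,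
although `∂₀` is missing: `∂_v f` can only be a multiple of a power of `x₀`, and that multiple
vanishes by a count of parallel classes. -/
theorem diffOp_genIndepPoly_eq_zero {d k : ℕ} {M : Matroid (Fin n)}
    (hM : M.E.ncard ≤ d + 3 + k) (hB : ∀ B, M.IsBase B → d + 3 ≤ B.ncard) {v : Fin (n + 1) → ℝ}
    (hv : ∀ i : Fin n, diffOp (linearForm v) (pderiv i.succ (genIndepPoly (d + 3) k M)) = 0) :
    diffOp (linearForm v) (genIndepPoly (d + 3) k M) = 0 := by
  refine eq_zero_of_pderiv_succ_eq_zero (d + 2) _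
    (isHomogeneous_diffOp (isHomogeneous_linearForm v) (isHomogeneous_genIndepPoly hM))
    (fun i => by rw [← diffOp_pderiv, hv]) ?_
  have hev : ∀ (m k : ℕ) (M : Matroid (Fin n)),
      pairing (diffOp (linearForm v) (genIndepPoly (1 + m) k M)) (X 0 ^ m)
        = (k + m).factorial * (((k + m : ℕ) + 1) * v 0 + ∑ i ∈ nonloops M, v i.succ) := by
    intro m k M
    rw [← pairing_mul, mul_comm, pairing_genIndepPoly_X_zero_pow_mul,
      pairing_genIndepPoly_one]
  have hev0 : ∀ (m k : ℕ) (M : Matroid (Fin n)),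
      diffOp (linearForm v) (genIndepPoly (1 + m) k M) = 0 →
        ((k + m : ℕ) + 1) * v 0 + ∑ i ∈ nonloops M, v i.succ = 0 := by
    intro m k M h
    have h1 := hev m k M
    rw [h, pairing_zero_left] at h1
    exact (mul_eq_zero.1 h1.symm).resolve_left (by positivity)
  have hd1 : ∀ i, M.IsNonloop i →
      diffOp (linearForm v) (genIndepPoly (d + 2) k (M ／ {i})) = 0 := fun i hi => by
    rw [← pderiv_succ_genIndepPoly (d + 2) k hi]
    exact hv i
  obtain ⟨i, j, hi, hj⟩ : ∃ i j, M.IsNonloop i ∧ (M ／ {i}).IsNonloop j := by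
    have hex : ∀ (M : Matroid (Fin n)) (r : ℕ), (∀ B, M.IsBase B → r + 1 ≤ B.ncard) →
        ∃ i, M.IsNonloop i := by
      intro M r hM
      obtain ⟨B, hB⟩ := M.exists_isBase
      have h1 := hM B hB
      obtain ⟨i, hi⟩ : B.Nonempty := by
        rw [Set.nonempty_iff_ne_empty]
        rintro rfl
        simp at h1
      exact ⟨i, hB.indep.isNonloop_of_mem hi⟩
    obtain ⟨i, hi⟩ := hex M _ hB
    obtain ⟨j, hj⟩ := hex (M ／ {i}) _ (succ_le_ncard_of_isBase_contractElem hB hi)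
    exact ⟨i, j, hi, hj⟩
  have key := mul_add_sum_nonloops_eq_zero (M := M) (N := k + d + 3) (v₀ := v 0)
    (w := fun i => v i.succ) (by omega) ((card_nonloops_le M).trans (by omega))
    (fun i hi => by
      have h := hev0 (d + 1) k (M ／ {i}) (by rw [add_comm 1]; exact hd1 i hi)
      push_cast at h ⊢
      linarith)
    (fun i j hi hj => by
      have h := hev0 d k (M ／ {i} ／ {j}) (by
        rw [add_comm 1, ← pderiv_succ_genIndepPoly (d + 1) k hj, diffOp_pderiv, hd1 i hi,
          map_zero])
      push_cast at h ⊢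
      linarith) hi hj
  have h := hev (d + 2) k M
  rw [show 1 + (d + 2) = d + 3 by omega] at h
  rw [h]
  push_cast at key ⊢
  rw [show ((k : ℝ) + (d + 2) + 1) = k + d + 3 by ring, key, mul_zero]

/-- The weight `a 0` may vanish here; the Hodge index inequality is then obtained as a limit, and
strictness by induction over contractions. -/
theorem strictHodgeIndexAt_genIndepPoly {a : Fin (n + 1) → ℝ} (ha0 : 0 ≤ a 0)
    (ha : ∀ i : Fin n, 0 < a i.succ) (d : ℕ) :
    ∀ k (M : Matroid (Fin n)), M.E.ncard ≤ d + 2 + k → (∀ B, M.IsBase B → d + 2 ≤ B.ncard) →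
      StrictHodgeIndexAt (genIndepPoly (d + 2) k M) d a := by
  have ha' : ∀ s, 0 ≤ a s := Fin.cases ha0 fun i => (ha i).le
  have hindex : ∀ d k (M : Matroid (Fin n)), M.E.ncard ≤ d + 2 + k →
      (∀ B, M.IsBase B → d + 2 ≤ B.ncard) → HodgeIndexAt (genIndepPoly (d + 2) k M) d a := by
    intro d k M hM hB
    refine HodgeIndexAt.of_forall_pos (b := Pi.single 0 1)
      (pairing_genIndepPoly_pos_of_isBase ha' ha _ k M hB) fun t ht => ?_
    refine hodgeIndexAt_genIndepPoly (Fin.cases ?_ fun i => ?_) d k M hM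
    · simpa using add_pos_of_nonneg_of_pos ha0 ht
    · simpa using ha i
  induction d with
  | zero => exact fun k M hM hB => ⟨hindex 0 k M hM hB, fun v hv => by simpa using hv⟩
  | succ d ih =>
    refine fun k M hM hB => ⟨hindex (d + 1) k M hM hB, fun v hv => ?_⟩
    refine diffOp_genIndepPoly_eq_zero hM hB fun i => ?_
    refine diffOp_pderiv_eq_zero_of_strictHodgeIndexAt (isHomogeneous_genIndepPoly hM) ha'
      (Fin.cases (fun _ => Or.inr ?_) fun j _ => ?_) hv (ha i)
    · rw [pderiv_zero_genIndepPoly]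
      exact ih (k + 1) M (by omega) fun B h => (Nat.le_succ _).trans (hB B h)
    · by_cases hj : M.IsNonloop j
      · have := ncard_ground_contractElem hj
        rw [pderiv_succ_genIndepPoly (d + 2) k hj]
        exact Or.inr (ih k _ (by omega) (succ_le_ncard_of_isBase_contractElem hB hj))
      · exact Or.inl (pderiv_succ_genIndepPoly_of_not_isNonloop _ k hj)

theorem reducedIndepPoly_eq (M : Matroid (Fin n)) (hM : M.eRank.toNat ≤ n) :
    reducedIndepPoly M = genIndepPoly M.eRank.toNat (n - M.eRank.toNat) M := by
  rw [reducedIndepPoly, genIndepPoly, indepPoly, Nat.add_sub_cancel' hM]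

theorem linForm_eq (a : Fin n → ℝ) : linForm a = linearForm (Fin.cons 0 a) := by
  rw [linearForm_apply, Fin.sum_univ_succ, linForm, Fin.cons_zero, zero_smul, zero_add]
  exact Finset.sum_congr rfl fun i _ => by rw [Fin.cons_succ, smul_eq_C_mul]

end HodgeIndex

end HodgeRiemann

theorem theorem4p1 (n : ℕ) (M : Matroid (Fin n)) (hE : M.E = Set.univ) (hr : 2 ≤ M.eRank)
    (a : Fin n → ℝ) (ha : ∀ i, 0 < a i) :
    HodgeRiemann.HasHRR (HodgeRiemann.reducedIndepPoly M) 1 (HodgeRiemann.linForm a) := by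
  have hB : ∀ B, M.IsBase B → B.ncard = M.eRank.toNat := fun B hB => by
    rw [Set.ncard_def, hB.encard_eq_eRank]
  obtain ⟨B, hBase⟩ := M.exists_isBase
  have hne : M.eRank ≠ ⊤ := by
    rw [← hBase.encard_eq_eRank]
    exact Set.encard_ne_top_iff.2 (Set.toFinite B)
  have hr2 : 2 ≤ M.eRank.toNat := by
    rw [← ENat.natCast_toNat hne] at hr
    exact_mod_cast hr
  have hEn : M.E.ncard = n := by rw [hE, Set.ncard_univ, Nat.card_fin]
  have hrn : M.eRank.toNat ≤ n := by
    rw [← hB B hBase]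
    exact (Set.ncard_le_ncard hBase.subset_ground (Set.toFinite _)).trans_eq hEn
  rw [HodgeRiemann.reducedIndepPoly_eq M hrn, HodgeRiemann.linForm_eq]
  obtain ⟨d, hd⟩ := Nat.exists_eq_add_of_le' hr2
  rw [hd] at hB hrn ⊢
  have hcard : M.E.ncard ≤ d + 2 + (n - (d + 2)) := by omega
  refine (HodgeRiemann.strictHodgeIndexAt_genIndepPoly ?_ (fun i => ?_) d _ M hcard
    fun B h => (hB B h).ge).hasHRR_one (HodgeRiemann.isHomogeneous_genIndepPoly hcard)
  · rw [Fin.cons_zero]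
  · rw [Fin.cons_succ]; exact ha i
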